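/- Let $\theta_{hl}<\theta_+$ be real numbers, let $W\subset\mathbb R$ be an open set containing $[\theta_{hl},\theta_+]$, and let $F$ be a $C^\infty$ function on $W$ whose unique zero in $W$ is $\theta_+$ and which satisfies $F'(\theta_+)<0$. For $c\ge 0$ consider on $W\times\mathbb R$ the vector field $$X_c:\qquad u'=v,\qquad v'=cv-F(u),$$ and let $p_0=(\theta_+,0)$. Let the stable separatrix $S_c$ be the part of the stable manifold of $p_0$ lying in $[\theta_{hl},\theta_+]\times[0,\infty)$, that is, the set of points of $[\theta_{hl},\theta_+]\times[0,\infty)$ whose trajectory under $X_c$ exists in $W\times\mathbb R$ for all $t\ge 0$ and tends to $p_0$ as $t\to+\infty$. Then for every $c\ge 0$ the set $S_c$ is the graph $\{(u,v(u,c)) : u\in[\theta_{hl},\theta_+]\}$ of a function $v(\cdot,c)$, with $v(u,c)>0$ for $u\in[\theta_{hl},\theta_+)$. There is a trajectory $\gamma_c(t)=(u_\gamma(t,c),v_\gamma(t,c))$, $t\ge0$, of $X_c$ in $W\times\mathbb R$ with $\gamma_c(0)=(\theta_{hl},v(\theta_{hl},c))$ and $\gamma_c(t)\to p_0$ as $t\to+\infty$.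 For any such trajectory and any $u\in[\theta_{hl},\theta_+)$ there is exactly one time $t(u)\ge 0$ with $u_\gamma(t(u),c)=u$. Moreover, for all $u\in[\theta_{hl},\theta_+)$ and $c\ge 0$, the function $c\mapsto v(u,c)$ on $[0,\infty)$ is differentiable at $c$ (from the right if $c=0$), the integral below converges, and $$\partial_c v(u,c)=-\frac{1}{v(u,c)}\int_0^{\infty}e^{-ct}\,v_\gamma\bigl(t+t(u),c\bigr)^2\,dt .$$ In particular $\partial_c v(u,c)<0$. -/

import Mathlib

open Set Filter Topology MeasureTheory
open scoped ContDiff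

namespace Separatrix

/-- The planar vector field `X_c (u, v) = (v, c v - F u)`. -/
def field (F : ℝ → ℝ) (c : ℝ) (p : ℝ × ℝ) : ℝ × ℝ :=
  (p.2, c * p.2 - F p.1)

/-- `γ` restricted to `[0, ∞)` is a trajectory of `X_c` in the strip `W × ℝ`
(the derivative at `t = 0` is one-sided; values at negative times are irrelevant). -/
structure IsForwardTrajectory (F : ℝ → ℝ) (W : Set ℝ) (c : ℝ) (γ : ℝ → ℝ × ℝ) : Prop where
  mem : ∀ t, 0 ≤ t → (γ t).1 ∈ W
  ode : ∀ t, 0 ≤ t → HasDerivWithinAt γ (field F c (γ t)) (Ici 0) t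

/-- The stable manifold, in the strip `W × ℝ`, of the point `(θp, 0)` for the field `X_c`:
the points whose forward trajectory stays in the strip and tends to `(θp, 0)`. -/
def stableManifold (F : ℝ → ℝ) (W : Set ℝ) (θp c : ℝ) : Set (ℝ × ℝ) :=
  {p | ∃ γ : ℝ → ℝ × ℝ, IsForwardTrajectory F W c γ ∧ γ 0 = p ∧
    Tendsto γ atTop (𝓝 (θp, 0))}

/-- The stable separatrix `S_c`: the part of the stable manifold of `(θp, 0)` that lies in
`[θhl, θp] × [0, ∞)`. -/
def stableSeparatrix (F : ℝ → ℝ) (W : Set ℝ) (θhl θp c : ℝ) : Set (ℝ × ℝ) :=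
  stableManifold F W θp c ∩ Icc θhl θp ×ˢ Ici 0

/-- The number `v(u, c)`: the ordinate of the point of `S_c` above `u`. (The supremum only
serves to name that point; that there is exactly one is part of the theorem.) -/
noncomputable def height (F : ℝ → ℝ) (W : Set ℝ) (θhl θp u c : ℝ) : ℝ :=
  sSup {y | (u, y) ∈ stableSeparatrix F W θhl θp c}

/-- `γ` is the trajectory `γ_c` running along the separatrix: it starts at
`(θhl, v(θhl, c))` at time `0` and tends to `(θp, 0)`. -/
structure IsSeparatrixTrajectory (F : ℝ → ℝ) (W : Set ℝ) (θhl θp c : ℝ)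
    (γ : ℝ → ℝ × ℝ) : Prop where
  traj : IsForwardTrajectory F W c γ
  init : γ 0 = (θhl, height F W θhl θp θhl c)
  lim : Tendsto γ atTop (𝓝 (θp, 0))

end Separatrix

/-!
Extend the interval `[θhl, θp]` a little to the left and call the result `[a, b]`. Along a
trajectory tending to `(b, 0)` the energy `v² + 2 ∫_b^u F` increases to `0`, which gives
`|v| ≤ κ (b - u)` while `u ∈ [a, b]`; hence `u` never reaches `b`, so `F(u) > 0` throughout, and
`(e^{-ct} v)' = -e^{-ct} F(u)` forces `v > 0`.

In the phase plane the separatrix is therefore a graph `v = V(u)` with `V dV/du = c V - F` and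
`V(b) = 0`. Existence is a terminal value problem for `P = V²`, whose right-hand side
`2(c√P - F)` is continuous and nondecreasing in `P`: this makes solutions backwards from `b` stable
under perturbation, so Lipschitz approximations converge. Any trajectory on the separatrix lies on
the graph because `(v - V(u))²` increases along it and tends to `0`.

Let `V` and `V'` be the graphs for the speeds `c` and `c'`. Integrating
`d/dt [e^{-ct} (V'(u)² - V(u)²) / 2]` along the trajectory `du/dt = V(u)` expresses
`V(u(0))² - V'(u(0))²` exactly as an integral over `(0, ∞)`. Divided by `c' - c`, its integrand
converges to `2 e^{-ct} v²`, dominated by a multiple of `V(u) = du/dt` plus one of `c e^{-ct}`.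
-/

namespace Separatrix

section Calculus

variable {a b m : ℝ} {f : ℝ → ℝ}

theorem exists_first_hitting (hf : ContinuousOn f (Icc a b)) (hab : a ≤ b) (ha : f a < m)
    (hb : m ≤ f b) : ∃ s ∈ Ioc a b, f s = m ∧ ∀ t ∈ Ico a s, f t < m := by
  have hne : (Icc a b ∩ f ⁻¹' Ici m).Nonempty := ⟨b, ⟨hab, le_rfl⟩, hb⟩
  obtain ⟨s, ⟨hs, hms⟩, hleast⟩ :=
    (isCompact_Icc.of_isClosed_subset (hf.preimage_isClosed_of_isClosed isClosed_Icc isClosed_Ici)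
      inter_subset_left).exists_isLeast hne
  have hbefore : ∀ t ∈ Ico a s, f t < m := fun t ht => not_le.1 fun hmt =>
    ht.2.not_ge (hleast ⟨⟨ht.1, ht.2.le.trans hs.2⟩, hmt⟩)
  have has : a < s := hs.1.lt_of_ne fun h => ha.not_ge (h ▸ hms)
  refine ⟨s, ⟨has, hs.2⟩, hms.antisymm' ?_, hbefore⟩
  have hlim : Tendsto f (𝓝[Ico a s] s) (𝓝 (f s)) :=
    (hf s hs).mono_left (nhdsWithin_mono _ (Ico_subset_Icc_self.trans (Icc_subset_Icc_right hs.2)))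
  have : (𝓝[Ico a s] s).NeBot := by rw [nhdsWithin_Ico_eq_nhdsLT has]; infer_instance
  exact le_of_tendsto hlim (eventually_mem_nhdsWithin.mono fun t ht => (hbefore t ht).le)

theorem nonpos_of_deriv_nonneg_where_pos {h : ℝ → ℝ} (hc : ContinuousOn h (Icc a b))
    (hb : h b ≤ 0) (hd : ∀ x ∈ Ioo a b, 0 < h x → ∃ d, 0 ≤ d ∧ HasDerivAt h d x) :
    ∀ x ∈ Icc a b, h x ≤ 0 := by
  intro x hx
  by_contra! hpos
  obtain ⟨s, hs, hs0, hbefore⟩ := exists_first_hitting (f := fun y => -h y) (m := 0)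
    (hc.mono (Icc_subset_Icc_left hx.1)).neg hx.2 (by linarith) (by linarith)
  have hsub : Icc x s ⊆ Icc a b := Icc_subset_Icc hx.1 hs.2
  have hmono : MonotoneOn h (Icc x s) := by
    have hder : ∀ y ∈ interior (Icc x s), ∃ d, 0 ≤ d ∧ HasDerivAt h d y := fun y hy => by
      rw [interior_Icc] at hy
      exact hd y ⟨hx.1.trans_lt hy.1, hy.2.trans_le hs.2⟩
        (neg_neg_iff_pos.1 (hbefore y ⟨hy.1.le, hy.2⟩))
    choose! d hd0 hd using hder
    exact monotoneOn_of_hasDerivWithinAt_nonneg (convex_Icc x s) (hc.mono hsub)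
      (fun y hy => (hd y hy).hasDerivWithinAt) hd0
  have := hmono ⟨le_rfl, hs.1.le⟩ ⟨hs.1.le, le_rfl⟩ hs.1.le
  linarith

theorem le_of_monotoneOn_of_tendsto {l : ℝ} (hf : MonotoneOn f (Ici a))
    (hlim : Tendsto f atTop (𝓝 l)) {t : ℝ} (ht : a ≤ t) : f t ≤ l :=
  ge_of_tendsto hlim ((eventually_ge_atTop t).mono fun _ hs => hf ht (ht.trans hs) hs)

theorem tendsto_exp_neg_mul_mul_zero {c : ℝ} (hc : 0 ≤ c) (hf : Tendsto f atTop (𝓝 0)) :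
    Tendsto (fun t => Real.exp (-(c * t)) * f t) atTop (𝓝 0) := by
  refine squeeze_zero_norm' ((eventually_ge_atTop 0).mono fun t ht => ?_)
    (tendsto_zero_iff_norm_tendsto_zero.1 hf)
  rw [norm_mul, Real.norm_of_nonneg (Real.exp_pos _).le]
  exact mul_le_of_le_one_left (norm_nonneg _)
    (Real.exp_le_one_iff.2 (neg_nonpos.2 (mul_nonneg hc ht)))

theorem uniformCauchySeqOn_of_sub_le {X : Type*} {P : ℕ → X → ℝ} {s : Set X} {e : ℕ → ℝ}
    (he : Tendsto e atTop (𝓝 0)) (hP : ∀ m n, ∀ x ∈ s, P m x - P n x ≤ e m + e n) :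
    UniformCauchySeqOn P atTop s := by
  refine Metric.uniformCauchySeqOn_iff.2 fun η hη => ?_
  obtain ⟨N, hN⟩ := eventually_atTop.1 (he.eventually_lt_const (half_pos hη))
  have hlt : ∀ m ≥ N, ∀ n ≥ N, ∀ x ∈ s, P m x - P n x < η := fun m hm n hn x hx => by
    linarith [hP m n x hx, hN m hm, hN n hn]
  exact ⟨N, fun m hm n hn x hx =>
    abs_sub_lt_iff.2 ⟨hlt m hm n hn x hx, hlt n hn m hm x hx⟩⟩

end Calculus

section TerminalProblem

variable {G g₁ g₂ f P Q : ℝ → ℝ} {a b B δ ε p₀ : ℝ}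

/-- `P` solves the terminal value problem `P' = G(P) - f(x)`, `P(b) = p₀` on `[a, b]`; the
equation is only required in the open interval. -/
structure IsTerminalSolution (G f : ℝ → ℝ) (a b p₀ : ℝ) (P : ℝ → ℝ) : Prop where
  continuousOn : ContinuousOn P (Icc a b)
  right_eq : P b = p₀
  hasDerivAt : ∀ x ∈ Ioo a b, HasDerivAt P (G (P x) - f x) x

theorem exists_isTerminalSolution_of_lipschitzWith {K : NNReal} (hG : LipschitzWith K G)
    (hGB : ∀ p, |G p| ≤ B) (hf : ContinuousOn f (Icc a b)) (hab : a ≤ b) (p₀ : ℝ) :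
    ∃ P, IsTerminalSolution G f a b p₀ P := by
  obtain ⟨C, hC⟩ := isCompact_Icc.exists_bound_of_continuousOn hf
  have hC0 : 0 ≤ C := (norm_nonneg _).trans (hC a ⟨le_rfl, hab⟩)
  have hB0 : 0 ≤ B := (abs_nonneg _).trans (hGB 0)
  have hpl : IsPicardLindelof (fun x p => G p - f x) (⟨b, hab, le_rfl⟩ : Icc a b) p₀
      (NNReal.mk ((B + C) * (b - a)) (mul_nonneg (by positivity) (sub_nonneg.2 hab))) 0
      (NNReal.mk (B + C) (by positivity)) K :=
    { lipschitzOnWith := fun x _ => by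
        simpa using (hG.sub (LipschitzWith.const (f x))).lipschitzOnWith
      continuousOn := fun p _ => continuousOn_const.sub hf
      norm_le := fun x hx p _ => (norm_sub_le _ _).trans (add_le_add (hGB p) (hC x hx))
      mul_max_le := by simp [hab] }
  obtain ⟨P, hPb, hP⟩ := hpl.exists_eq_forall_mem_Icc_hasDerivWithinAt₀
  exact ⟨P, fun x hx => (hP x hx).continuousWithinAt, hPb, fun x hx =>
    (hP x (Ioo_subset_Icc_self hx)).hasDerivAt (Icc_mem_nhds hx.1 hx.2)⟩

theorem exists_lipschitzWith_approx (hG : UniformContinuous G) (hGB : ∀ p, |G p| ≤ B)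
    (hε : 0 < ε) : ∃ g : ℝ → ℝ, ∃ K : NNReal, LipschitzWith K g ∧ ∀ p, |g p - G p| ≤ ε := by
  obtain ⟨h, hh, hGh⟩ := Metric.uniformContinuous_iff.1 hG ε hε
  set I : ℝ → ℝ := fun p => ∫ s in (0 : ℝ)..p, G s
  have hI : ∀ p, HasDerivAt I (G p) p := fun p =>
    intervalIntegral.integral_hasDerivAt_right (hG.continuous.intervalIntegrable _ _)
      hG.continuous.stronglyMeasurable.stronglyMeasurableAtFilter hG.continuous.continuousAt
  have hd : ∀ p, HasDerivAt (fun p => (I (p + h) - I p) / h) ((G (p + h) - G p) / h) p :=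
    fun p => (((hI (p + h)).comp_add_const p h).sub (hI p)).div_const h
  have hK : 0 ≤ (B + B) / h := div_nonneg (by linarith [hGB 0, abs_nonneg (G 0)]) hh.le
  refine ⟨_, NNReal.mk _ hK, lipschitzWith_of_nnnorm_deriv_le (fun p => (hd p).differentiableAt)
    fun p => ?_, fun p => ?_⟩
  · rw [(hd p).deriv, ← NNReal.coe_le_coe, coe_nnnorm, NNReal.coe_mk, norm_div,
      Real.norm_of_nonneg hh.le]
    gcongr
    exact (norm_sub_le _ _).trans (add_le_add (hGB _) (hGB _))
  · obtain ⟨q, hq, hslope⟩ := exists_hasDerivAt_eq_slope I G (lt_add_of_pos_right p hh)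
      (fun q _ => (hI q).continuousAt.continuousWithinAt) fun q _ => hI q
    rw [add_sub_cancel_left] at hslope
    rw [← hslope]
    refine (hGh ?_).le
    rw [Real.dist_eq, abs_of_pos (sub_pos.2 hq.1)]
    linarith [hq.2]

theorem IsTerminalSolution.sub_le (hG : Monotone G) (hP : IsTerminalSolution g₁ f a b p₀ P)
    (hQ : IsTerminalSolution g₂ f a b p₀ Q) (h₁ : ∀ p, |g₁ p - G p| ≤ ε)
    (h₂ : ∀ p, |g₂ p - G p| ≤ δ) : ∀ x ∈ Icc a b, P x - Q x ≤ (ε + δ) * (b - x) := by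
  have hline : ∀ x, HasDerivAt (fun x => (ε + δ) * (b - x)) (-(ε + δ)) x := fun x => by
    simpa using ((hasDerivAt_id x).const_sub b).const_mul (ε + δ)
  have key := nonpos_of_deriv_nonneg_where_pos
    (h := fun x => P x - Q x - (ε + δ) * (b - x))
    ((hP.continuousOn.sub hQ.continuousOn).sub (by fun_prop))
    (by simp [hP.right_eq, hQ.right_eq]) fun x hx hpos => ⟨_, ?_,
      ((hP.hasDerivAt x hx).sub (hQ.hasDerivAt x hx)).sub (hline x)⟩
  · exact fun x hx => sub_nonpos.1 (key x hx)
  · have hε : 0 ≤ ε := (abs_nonneg _).trans (h₁ 0)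
    have hδ : 0 ≤ δ := (abs_nonneg _).trans (h₂ 0)
    have hGG : G (Q x) ≤ G (P x) := by
      have := mul_nonneg (add_nonneg hε hδ) (sub_nonneg.2 hx.2.le)
      exact hG (by linarith)
    linarith [neg_le_of_abs_le (h₁ (P x)), le_of_abs_le (h₂ (Q x))]

theorem exists_isTerminalSolution_of_monotone (hG : Monotone G) (hGc : UniformContinuous G)
    (hGB : ∀ p, |G p| ≤ B) (hf : ContinuousOn f (Icc a b)) (hab : a ≤ b) (p₀ : ℝ) :
    ∃ P, IsTerminalSolution G f a b p₀ P := by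
  have hε : ∀ n : ℕ, (0 : ℝ) < 1 / (n + 1) := fun n => Nat.one_div_pos_of_nat
  choose g K hgK hgG using fun n => exists_lipschitzWith_approx hGc hGB (hε n)
  have hgB : ∀ n p, |g n p| ≤ 1 / (n + 1) + B := fun n p => by
    simpa using (abs_add_le (g n p - G p) (G p)).trans (add_le_add (hgG n p) (hGB p))
  choose P hP using fun n =>
    exists_isTerminalSolution_of_lipschitzWith (hgK n) (hgB n) hf hab p₀
  have hcauchy : UniformCauchySeqOn P atTop (Icc a b) := by
    refine uniformCauchySeqOn_of_sub_le (e := fun n => 1 / ((n : ℝ) + 1) * (b - a))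
      (by simpa using tendsto_one_div_add_atTop_nhds_zero_nat.mul_const (b - a))
      fun m n x hx => ((hP m).sub_le hG (hP n) (hgG m) (hgG n) x hx).trans ?_
    rw [← add_mul]
    gcongr
    exact hx.1
  choose! R hR using fun x (hx : x ∈ Icc a b) =>
    cauchySeq_tendsto_of_complete (hcauchy.cauchySeq hx)
  have hPR : TendstoUniformlyOn P R atTop (Icc a b) :=
    hcauchy.tendstoUniformlyOn_of_tendsto fun x hx => hR x hx
  have hgR : TendstoUniformlyOn (fun n x => g n (P n x) - f x) (fun x => G (R x) - f x) atTop
      (Icc a b) := by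
    have hGR := hGc.comp_tendstoUniformlyOn hPR
    rw [Metric.tendstoUniformlyOn_iff] at hGR ⊢
    intro η hη
    obtain ⟨N, hN⟩ := exists_nat_one_div_lt (half_pos hη)
    filter_upwards [hGR (η / 2) (half_pos hη), eventually_ge_atTop N] with n hn hNn x hx
    have hgn : dist (G (P n x)) (g n (P n x)) < η / 2 := by
      rw [dist_comm]
      exact ((hgG n _).trans (Nat.one_div_le_one_div hNn)).trans_lt hN
    have hGn : dist (G (R x)) (G (P n x)) < η / 2 := hn x hx
    rw [dist_sub_right]
    linarith [dist_triangle (G (R x)) (G (P n x)) (g n (P n x))]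
  refine ⟨R, hPR.continuousOn (Frequently.of_forall fun n => (hP n).continuousOn), ?_,
    fun x hx => ?_⟩
  · exact tendsto_nhds_unique (hR b ⟨hab, le_rfl⟩) (by simp [(hP _).right_eq])
  · exact hasDerivAt_of_tendstoUniformlyOn isOpen_Ioo (hgR.mono Ioo_subset_Icc_self)
      (Eventually.of_forall fun n y hy => (hP n).hasDerivAt y hy)
      (fun y hy => hR y (Ioo_subset_Icc_self hy)) hx

end TerminalProblem

section Profile

/-- `F` is positive inside `[a, b]` and vanishes at least linearly at `b`. The constant is written
`κ²` because profiles over `[a, b]` then have slope at most `κ` at `b`. -/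
structure IsReaction (F : ℝ → ℝ) (a b κ : ℝ) : Prop where
  lt : a < b
  nonneg : 0 ≤ κ
  continuousOn : ContinuousOn F (Icc a b)
  pos : ∀ x ∈ Ioo a b, 0 < F x
  le : ∀ x ∈ Icc a b, F x ≤ κ ^ 2 * (b - x)

/-- `V` is the graph over `[a, b]` of an orbit of `X_c` in the upper half-plane ending at
`(b, 0)`. -/
structure IsProfile (F : ℝ → ℝ) (a b c : ℝ) (V : ℝ → ℝ) : Prop where
  continuousOn : ContinuousOn V (Icc a b)
  right_eq : V b = 0
  pos : ∀ x ∈ Ioo a b, 0 < V x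
  hasDerivAt : ∀ x ∈ Ioo a b, HasDerivAt V (c - F x / V x) x

variable {F V V' : ℝ → ℝ} {a b c c' κ : ℝ}

theorem IsReaction.le_parabola (hF : IsReaction F a b κ) {P : ℝ → ℝ}
    (hP : ContinuousOn P (Icc a b)) (hb : P b = 0)
    (hd : ∀ x ∈ Ioo a b, ∃ d, -(2 * F x) ≤ d ∧ HasDerivAt P d x) :
    ∀ x ∈ Icc a b, P x ≤ (κ * (b - x)) ^ 2 := by
  have hparabola : ∀ x, HasDerivAt (fun x => (κ * (b - x)) ^ 2) (-(2 * (κ ^ 2 * (b - x)))) x :=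
    fun x => ((((hasDerivAt_id x).const_sub b).const_mul κ).pow 2).congr_deriv (by simp; ring)
  have key := nonpos_of_deriv_nonneg_where_pos (h := fun x => P x - (κ * (b - x)) ^ 2)
    (hP.sub (by fun_prop)) (by simp [hb]) fun x hx _ => by
      obtain ⟨d, hd, hPd⟩ := hd x hx
      exact ⟨_, by linarith [hF.le x (Ioo_subset_Icc_self hx)], hPd.sub (hparabola x)⟩
  exact fun x hx => sub_nonpos.1 (key x hx)

theorem uniformContinuous_sqrt_projIcc {M : ℝ} (hM : 0 ≤ M) :
    UniformContinuous fun p => √(projIcc 0 M hM p : ℝ) :=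
  (CompactSpace.uniformContinuous_of_continuous (f := fun p : Icc 0 M => √(p : ℝ))
    (by fun_prop)).comp (LipschitzWith.projIcc hM).uniformContinuous

theorem IsReaction.exists_sq_profile (hF : IsReaction F a b κ) (hc : 0 ≤ c) :
    ∃ P : ℝ → ℝ, ContinuousOn P (Icc a b) ∧ P b = 0 ∧ (∀ x ∈ Icc a b, 0 ≤ P x) ∧
      ∀ x ∈ Ioo a b, HasDerivAt P (2 * (c * √(P x) - F x)) x := by
  set M : ℝ := (κ * (b - a)) ^ 2
  have hM : 0 ≤ M := sq_nonneg _
  -- Clamping to `[0, M]` makes the right-hand side bounded and monotone; the solution turns out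
  -- to take values in `[0, M]`, so it solves the original equation.
  set G : ℝ → ℝ := fun p => 2 * c * √(projIcc 0 M hM p : ℝ)
  have hG0 : ∀ p, 0 ≤ G p := fun p => by positivity
  have hGM : ∀ p, |G p| ≤ 2 * c * √M := fun p => by
    rw [abs_of_nonneg (hG0 p)]
    exact mul_le_mul_of_nonneg_left (Real.sqrt_le_sqrt (projIcc 0 M hM p).2.2) (by positivity)
  have hGmono : Monotone G := fun p q hpq =>
    mul_le_mul_of_nonneg_left (Real.sqrt_le_sqrt (monotone_projIcc hM hpq)) (by positivity)
  obtain ⟨P, hP⟩ := exists_isTerminalSolution_of_monotone hGmono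
    ((uniformContinuous_sqrt_projIcc hM).const_mul' _) hGM (hF.continuousOn.const_mul 2)
    hF.lt.le 0
  have hPM : ∀ x ∈ Icc a b, P x ≤ M := fun x hx => by
    refine (hF.le_parabola hP.continuousOn hP.right_eq (fun y hy =>
      ⟨_, by linarith [hG0 (P y)], hP.hasDerivAt y hy⟩) x hx).trans
      (pow_le_pow_left₀ (mul_nonneg hF.nonneg (sub_nonneg.2 hx.2)) ?_ 2)
    exact mul_le_mul_of_nonneg_left (sub_le_sub_left hx.1 b) hF.nonneg
  have hP0 : ∀ x ∈ Icc a b, 0 ≤ P x := fun x hx => by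
    refine neg_nonpos.1 (nonpos_of_deriv_nonneg_where_pos (h := fun x => -P x)
      hP.continuousOn.neg (by simp [hP.right_eq]) (fun y hy hneg => ⟨_, ?_,
        (hP.hasDerivAt y hy).neg⟩) x hx)
    have : G (P y) = 0 := by simp [G, projIcc_of_le_left hM (neg_pos.1 hneg).le]
    linarith [hF.pos y hy]
  refine ⟨P, hP.continuousOn, hP.right_eq, hP0, fun x hx => ?_⟩
  have hxI := Ioo_subset_Icc_self hx
  refine (hP.hasDerivAt x hx).congr_deriv ?_
  simp only [G, projIcc_of_mem hM ⟨hP0 x hxI, hPM x hxI⟩]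
  ring

theorem IsReaction.exists_isProfile (hF : IsReaction F a b κ) (hc : 0 ≤ c) :
    ∃ V, IsProfile F a b c V := by
  obtain ⟨P, hPc, hPb, hP0, hPd⟩ := hF.exists_sq_profile hc
  have hPpos : ∀ x ∈ Ioo a b, 0 < P x := fun x hx => by
    refine (hP0 x (Ioo_subset_Icc_self hx)).lt_of_ne fun h0 => ?_
    have hmin : IsLocalMin P x := by
      filter_upwards [Icc_mem_nhds hx.1 hx.2] with y hy using h0 ▸ hP0 y hy
    have hcrit := hmin.hasDerivAt_eq_zero (hPd x hx)
    rw [← h0, Real.sqrt_zero] at hcrit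
    linarith [hF.pos x hx]
  refine ⟨fun x => √(P x), hPc.sqrt, by simp [hPb], fun x hx => Real.sqrt_pos.2 (hPpos x hx),
    fun x hx => ((hPd x hx).sqrt (hPpos x hx).ne').congr_deriv ?_⟩
  have := Real.sqrt_pos.2 (hPpos x hx)
  field_simp

namespace IsProfile

theorem tendsto_comp (hV : IsProfile F a b c V) {u : ℝ → ℝ} (hu : Tendsto u atTop (𝓝 b))
    (hmem : ∀ t, 0 ≤ t → u t ∈ Ioo a b) : Tendsto (fun t => V (u t)) atTop (𝓝 0) := by
  have hab : a < b := (hmem 0 le_rfl).1.trans (hmem 0 le_rfl).2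
  have hcont := hV.continuousOn b ⟨hab.le, le_rfl⟩
  rw [ContinuousWithinAt, hV.right_eq] at hcont
  exact hcont.comp (tendsto_nhdsWithin_iff.2 ⟨hu, (eventually_ge_atTop 0).mono
    fun t ht => Ioo_subset_Icc_self (hmem t ht)⟩)

theorem hasDerivAt_sq (hV : IsProfile F a b c V) {x : ℝ} (hx : x ∈ Ioo a b) :
    HasDerivAt (fun x => V x ^ 2) (2 * (c * V x - F x)) x := by
  have := hV.pos x hx
  refine ((hV.hasDerivAt x hx).pow 2).congr_deriv ?_
  field_simp
  ring

theorem le (hV : IsProfile F a b c V) (hF : IsReaction F a b κ) (hc : 0 ≤ c) {x : ℝ}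
    (hx : x ∈ Icc a b) : V x ≤ κ * (b - x) := by
  refine le_of_sq_le_sq ?_ (mul_nonneg hF.nonneg (sub_nonneg.2 hx.2))
  exact hF.le_parabola (hV.continuousOn.pow 2) (by simp [hV.right_eq]) (fun y hy =>
    ⟨_, by linarith [mul_nonneg hc (hV.pos y hy).le], hV.hasDerivAt_sq hy⟩) x hx

theorem le_const (hV : IsProfile F a b c V) (hF : IsReaction F a b κ) (hc : 0 ≤ c) {x : ℝ}
    (hx : x ∈ Ioo a b) : V x ≤ κ * (b - a) :=
  (hV.le hF hc (Ioo_subset_Icc_self hx)).trans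
    (mul_le_mul_of_nonneg_left (sub_le_sub_left hx.1.le b) hF.nonneg)

theorem antitone_speed (hV : IsProfile F a b c V) (hV' : IsProfile F a b c' V') (hc : 0 ≤ c)
    (hcc' : c ≤ c') {x : ℝ} (hx : x ∈ Ioo a b) : V' x ≤ V x := by
  have key := nonpos_of_deriv_nonneg_where_pos (h := fun x => V' x ^ 2 - V x ^ 2)
    ((hV'.continuousOn.pow 2).sub (hV.continuousOn.pow 2)) (by simp [hV.right_eq, hV'.right_eq])
    (fun y hy hpos => ⟨_, ?_, (hV'.hasDerivAt_sq hy).sub (hV.hasDerivAt_sq hy)⟩)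
    x (Ioo_subset_Icc_self hx)
  · exact le_of_sq_le_sq (sub_nonpos.1 key) (hV.pos x hx).le
  · have hle : V y ≤ V' y := le_of_sq_le_sq (sub_pos.1 hpos).le (hV'.pos y hy).le
    linarith [mul_le_mul hcc' hle (hV.pos y hy).le (hc.trans hcc')]

theorem sq_sub_sq_le (hV : IsProfile F a b c V) (hV' : IsProfile F a b c' V')
    (hF : IsReaction F a b κ) (hc : 0 ≤ c) (hcc' : c ≤ c') {x : ℝ} (hx : x ∈ Ioo a b) :
    V x ^ 2 - V' x ^ 2 ≤ 2 * κ * (b - a) ^ 2 * (c' - c) := by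
  set K : ℝ := κ * (b - a)
  have hline : ∀ x, HasDerivAt (fun x => 2 * (c' - c) * K * (b - x)) (-(2 * (c' - c) * K)) x :=
    fun x => by simpa using ((hasDerivAt_id x).const_sub b).const_mul (2 * (c' - c) * K)
  have key := nonpos_of_deriv_nonneg_where_pos
    (h := fun x => V x ^ 2 - V' x ^ 2 - 2 * (c' - c) * K * (b - x))
    (((hV.continuousOn.pow 2).sub (hV'.continuousOn.pow 2)).sub (by fun_prop))
    (by simp [hV.right_eq, hV'.right_eq])
    (fun y hy _ => ⟨_, ?_, ((hV.hasDerivAt_sq hy).sub (hV'.hasDerivAt_sq hy)).sub (hline y)⟩)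
    x (Ioo_subset_Icc_self hx)
  · have hK : 0 ≤ K := mul_nonneg hF.nonneg (sub_nonneg.2 hF.lt.le)
    calc V x ^ 2 - V' x ^ 2 ≤ 2 * (c' - c) * K * (b - x) := sub_nonpos.1 key
      _ ≤ 2 * (c' - c) * K * (b - a) := by
        have := sub_nonneg.2 hcc'
        gcongr
        exact hx.1.le
      _ = 2 * κ * (b - a) ^ 2 * (c' - c) := by ring
  · have hVV' : V' y ≤ V y := hV.antitone_speed hV' hc hcc' hy
    have hV'K : V' y ≤ K := hV'.le_const hF (hc.trans hcc') hy
    nlinarith [mul_nonneg hc (sub_nonneg.2 hVV'),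
      mul_nonneg (sub_nonneg.2 hcc') (sub_nonneg.2 hV'K)]

theorem abs_sq_sub_sq_le (hV : IsProfile F a b c V) (hV' : IsProfile F a b c' V')
    (hF : IsReaction F a b κ) (hc : 0 ≤ c) (hc' : 0 ≤ c') {x : ℝ} (hx : x ∈ Ioo a b) :
    |V' x ^ 2 - V x ^ 2| ≤ 2 * κ * (b - a) ^ 2 * |c' - c| := by
  wlog hcc' : c ≤ c' generalizing c c' V V'
  · rw [abs_sub_comm, abs_sub_comm c']
    exact this hV' hV hc' hc (le_of_not_ge hcc')
  have hle : V' x ^ 2 ≤ V x ^ 2 :=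
    pow_le_pow_left₀ (hV'.pos x hx).le (hV.antitone_speed hV' hc hcc' hx) 2
  rw [abs_of_nonpos (sub_nonpos.2 hle), abs_of_nonneg (sub_nonneg.2 hcc'), neg_sub]
  exact hV.sq_sub_sq_le hV' hF hc hcc' hx

theorem abs_sub_le (hV : IsProfile F a b c V) (hV' : IsProfile F a b c' V')
    (hF : IsReaction F a b κ) (hc : 0 ≤ c) (hc' : 0 ≤ c') {x : ℝ} (hx : x ∈ Ioo a b) :
    |V' x - V x| ≤ 2 * κ * (b - a) ^ 2 / V x * |c' - c| := by
  have hVx := hV.pos x hx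
  have hV'x := hV'.pos x hx
  rw [div_mul_eq_mul_div, le_div_iff₀ hVx, mul_comm]
  refine le_trans ?_ (hV.abs_sq_sub_sq_le hV' hF hc hc' hx)
  rw [sq_sub_sq, abs_mul, abs_of_pos (add_pos hV'x hVx)]
  gcongr
  linarith

theorem sq_sub_le (hV : IsProfile F a b c V) (hV' : IsProfile F a b c' V')
    (hF : IsReaction F a b κ) (hc : 0 ≤ c) (hc' : 0 ≤ c') {x : ℝ} (hx : x ∈ Ioo a b) :
    (V' x - V x) ^ 2 ≤ 2 * κ * (b - a) ^ 2 * |c' - c| := by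
  refine le_trans ?_ (hV.abs_sq_sub_sq_le hV' hF hc hc' hx)
  rw [← sq_abs, sq, sq_sub_sq, abs_mul, abs_of_pos (add_pos (hV'.pos x hx) (hV.pos x hx))]
  gcongr
  rw [abs_sub_le_iff]
  constructor <;> linarith [hV.pos x hx, hV'.pos x hx]

end IsProfile

end Profile

section Orbit

variable {V u : ℝ → ℝ} {a b κ : ℝ}

theorem exists_hasDerivAt_comp_tendsto_atTop {w : ℝ → ℝ} (hw : Continuous w)
    (hpos : ∀ s, 0 < w s) (hle : ∀ s, w s ≤ κ) (s₀ : ℝ) :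
    ∃ σ : ℝ → ℝ, σ 0 = s₀ ∧ (∀ t, HasDerivAt σ (w (σ t)) t) ∧ StrictMono σ ∧
      Tendsto σ atTop atTop := by
  have hκ : 0 < κ := (hpos 0).trans_le (hle 0)
  have hinv : Continuous fun s => (w s)⁻¹ := hw.inv₀ fun s => (hpos s).ne'
  set T : ℝ → ℝ := fun s => ∫ r in s₀..s, (w r)⁻¹
  have hT : ∀ s, HasDerivAt T (w s)⁻¹ s := fun s =>
    intervalIntegral.integral_hasDerivAt_right (hinv.intervalIntegrable _ _)
      hinv.stronglyMeasurable.stronglyMeasurableAtFilter hinv.continuousAt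
  have hTmono : StrictMono T := strictMono_of_hasDerivAt_pos hT fun s => inv_pos.2 (hpos s)
  have hTlin : ∀ {r s}, r ≤ s → T r - r * κ⁻¹ ≤ T s - s * κ⁻¹ := fun hrs =>
    monotone_of_hasDerivAt_nonneg (fun s => (hT s).sub (hasDerivAt_mul_const κ⁻¹))
      (fun s => sub_nonneg.2 (inv_anti₀ (hpos s) (hle s))) hrs
  have hTtop : Tendsto T atTop atTop :=
    tendsto_atTop_mono' _ ((eventually_ge_atTop s₀).mono fun s hs => by
      simpa only [id_eq] using (by linarith [hTlin hs] : s * κ⁻¹ + (T s₀ - s₀ * κ⁻¹) ≤ T s))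
      (tendsto_atTop_add_const_right _ (T s₀ - s₀ * κ⁻¹)
        (tendsto_id.atTop_mul_const (inv_pos.2 hκ)))
  have hTbot : Tendsto T atBot atBot :=
    tendsto_atBot_mono' _ ((eventually_le_atBot s₀).mono fun s hs => by
      simpa only [id_eq] using (by linarith [hTlin hs] : T s ≤ s * κ⁻¹ + (T s₀ - s₀ * κ⁻¹)))
      (tendsto_atBot_add_const_right _ (T s₀ - s₀ * κ⁻¹)
        (tendsto_id.atBot_mul_const (inv_pos.2 hκ)))
  have hTc : Continuous T := continuous_iff_continuousAt.2 fun s => (hT s).continuousAt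
  set e : ℝ ≃o ℝ := hTmono.orderIsoOfSurjective T (hTc.surjective hTtop hTbot)
  have he : ∀ s, e s = T s := fun s => rfl
  refine ⟨e.symm, ?_, fun t => ?_, e.symm.strictMono, e.symm.tendsto_atTop⟩
  · rw [e.symm_apply_eq, he]
    exact intervalIntegral.integral_same.symm
  · simpa using (hT (e.symm t)).of_local_left_inverse e.symm.continuous.continuousAt
      (inv_pos.2 (hpos _)).ne' (Eventually.of_forall e.apply_symm_apply)

/-- `u` runs, in time `t ≥ 0`, along the orbit whose graph is `V` and tends to `b`: it solves
`u' = V(u)` in `(a, b)`. The derivative at `0` is one-sided. -/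
structure IsOrbit (V : ℝ → ℝ) (a b : ℝ) (u : ℝ → ℝ) : Prop where
  mem : ∀ t, 0 ≤ t → u t ∈ Ioo a b
  hasDerivWithinAt : ∀ t, 0 ≤ t → HasDerivWithinAt u (V (u t)) (Ici 0) t
  tendsto : Tendsto u atTop (𝓝 b)

theorem exists_isOrbit (hV : ContinuousOn V (Ioo a b)) (hpos : ∀ x ∈ Ioo a b, 0 < V x)
    (hle : ∀ x ∈ Ioo a b, V x ≤ κ * (b - x)) {x₀ : ℝ} (hx₀ : x₀ ∈ Ioo a b) :
    ∃ u, u 0 = x₀ ∧ IsOrbit V a b u := by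
  -- In the variable `s = -log (b - x)` the equation `x' = V(x)` becomes `s' = w(s)` with `w`
  -- bounded by `κ`; only `s ≥ s₀` matters.
  set s₀ : ℝ := -Real.log (b - x₀)
  have hs₀ : b - Real.exp (-s₀) = x₀ := by
    rw [neg_neg, Real.exp_log (sub_pos.2 hx₀.2), sub_sub_cancel]
  have hmem : ∀ s, s₀ ≤ s → b - Real.exp (-s) ∈ Ioo a b := fun s hs => by
    have := Real.exp_le_exp.2 (neg_le_neg hs)
    exact ⟨by linarith [hx₀.1], by linarith [Real.exp_pos (-s)]⟩
  have hmax : ∀ s, b - Real.exp (-max s s₀) ∈ Ioo a b := fun s => hmem _ (le_max_right _ _)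
  set w : ℝ → ℝ := fun s => Real.exp (max s s₀) * V (b - Real.exp (-max s s₀))
  have hw : Continuous w := (by fun_prop : Continuous fun s => Real.exp (max s s₀)).mul
    (hV.comp_continuous (by fun_prop) hmax)
  have hwpos : ∀ s, 0 < w s := fun s => mul_pos (Real.exp_pos _) (hpos _ (hmax s))
  have hwle : ∀ s, w s ≤ κ := fun s => by
    calc w s ≤ Real.exp (max s s₀) * (κ * (b - (b - Real.exp (-max s s₀)))) :=
          mul_le_mul_of_nonneg_left (hle _ (hmax s)) (Real.exp_pos _).le
      _ = κ := by rw [sub_sub_cancel, mul_left_comm, ← Real.exp_add, add_neg_cancel,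
          Real.exp_zero, mul_one]
  obtain ⟨σ, hσ0, hσ, hσmono, hσlim⟩ := exists_hasDerivAt_comp_tendsto_atTop hw hwpos hwle s₀
  have hσge : ∀ t, 0 ≤ t → s₀ ≤ σ t := fun t ht => hσ0 ▸ hσmono.monotone ht
  refine ⟨fun t => b - Real.exp (-σ t), by simp only [hσ0, hs₀], fun t ht => hmem _ (hσge t ht),
    fun t ht => ?_, ?_⟩
  · refine (((hσ t).neg.exp.const_sub b).congr_deriv ?_).hasDerivWithinAt
    simp only [w, Pi.neg_apply, max_eq_left (hσge t ht)]
    rw [mul_neg, neg_neg, ← mul_assoc, ← Real.exp_add, neg_add_cancel, Real.exp_zero, one_mul]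
  · simpa using (Real.tendsto_exp_neg_atTop_nhds_zero.comp hσlim).const_sub b

namespace IsOrbit

theorem continuousOn (hu : IsOrbit V a b u) : ContinuousOn u (Ici 0) := fun t ht =>
  (hu.hasDerivWithinAt t ht).continuousWithinAt

theorem hasDerivAt (hu : IsOrbit V a b u) {t : ℝ} (ht : 0 < t) : HasDerivAt u (V (u t)) t :=
  (hu.hasDerivWithinAt t ht.le).hasDerivAt (Ici_mem_nhds ht)

theorem strictMonoOn (hu : IsOrbit V a b u) (hV : ∀ x ∈ Ioo a b, 0 < V x) :
    StrictMonoOn u (Ici 0) :=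
  strictMonoOn_of_hasDerivWithinAt_pos (convex_Ici 0) hu.continuousOn
    (fun t ht => (hu.hasDerivWithinAt t (interior_subset ht)).mono interior_subset)
    fun t ht => hV _ (hu.mem t (interior_subset ht))

theorem existsUnique_time (hu : IsOrbit V a b u) (hV : ∀ x ∈ Ioo a b, 0 < V x) {x : ℝ}
    (hx : x ∈ Ico (u 0) b) : ∃! τ, 0 ≤ τ ∧ u τ = x := by
  obtain ⟨T, hT⟩ := (((hu.tendsto.eventually_const_lt hx.2).and (eventually_ge_atTop 0)).exists)
  obtain ⟨τ, hτ, hτx⟩ := intermediate_value_Icc hT.2 (hu.continuousOn.mono Icc_subset_Ici_self)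
    ⟨hx.1, hT.1.le⟩
  exact ⟨τ, ⟨hτ.1, hτx⟩, fun s hs =>
    (hu.strictMonoOn hV).injOn hs.1 hτ.1 (hs.2.trans hτx.symm)⟩

theorem integrableOn_speed (hu : IsOrbit V a b u) (hV : ∀ x ∈ Ioo a b, 0 < V x) :
    IntegrableOn (fun t => V (u t)) (Ioi 0) :=
  integrableOn_Ioi_deriv_of_nonneg (hu.continuousOn 0 self_mem_Ici) (fun _ ht => hu.hasDerivAt ht)
    (fun t ht => (hV _ (hu.mem t (le_of_lt ht))).le) hu.tendsto

end IsOrbit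

end Orbit

section SpeedDependence

variable {F V V' u : ℝ → ℝ} {a b c c' κ : ℝ}

theorem IsProfile.continuousOn_comp (hV' : IsProfile F a b c' V') (hu : IsOrbit V a b u) :
    ContinuousOn (fun t => V' (u t)) (Ici 0) :=
  hV'.continuousOn.comp hu.continuousOn fun t ht => Ioo_subset_Icc_self (hu.mem t ht)

/-- Along the orbit `u` of the profile `V` of speed `c`, the integrand whose integral over
`(0, ∞)` is half the gap `V² - V'²` at `u(0)`, for a profile `V'` of speed `c'`. -/
noncomputable def gapIntegrand (c c' : ℝ) (V V' u : ℝ → ℝ) (t : ℝ) : ℝ :=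
  Real.exp (-(c * t)) * ((c' - c) * (V (u t) * V' (u t)) - c / 2 * (V' (u t) - V (u t)) ^ 2)

theorem hasDerivAt_weighted_gap (hV : IsProfile F a b c V) (hV' : IsProfile F a b c' V')
    (hu : IsOrbit V a b u) {t : ℝ} (ht : 0 < t) :
    HasDerivAt (fun t => Real.exp (-(c * t)) * ((V' (u t) ^ 2 - V (u t) ^ 2) / 2))
      (gapIntegrand c c' V V' u t) t := by
  have hut := hu.mem t ht.le
  have hexp : HasDerivAt (fun t => Real.exp (-(c * t))) (Real.exp (-(c * t)) * -c) t := by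
    simpa using ((hasDerivAt_id t).const_mul c).neg.exp
  have hgap := (((hV'.hasDerivAt_sq hut).sub (hV.hasDerivAt_sq hut)).div_const 2).comp t
    (hu.hasDerivAt ht)
  refine (hexp.mul hgap).congr_deriv ?_
  simp only [gapIntegrand, Function.comp_apply, Pi.sub_apply]
  ring

theorem continuousOn_gapIntegrand (hV : IsProfile F a b c V) (hV' : IsProfile F a b c' V')
    (hu : IsOrbit V a b u) : ContinuousOn (gapIntegrand c c' V V' u) (Ici 0) := by
  have hVu := hV.continuousOn_comp hu
  have hV'u := hV'.continuousOn_comp hu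
  exact (by fun_prop : Continuous fun t => Real.exp (-(c * t))).continuousOn.mul
    ((continuousOn_const.mul (hVu.mul hV'u)).sub (continuousOn_const.mul ((hV'u.sub hVu).pow 2)))

/-- An integrable function of time which, up to the factor `|c' - c|`, dominates every
`gapIntegrand c c' V V' u`. -/
noncomputable def gapBound (a b c κ : ℝ) (V u : ℝ → ℝ) (t : ℝ) : ℝ :=
  κ * (b - a) * V (u t) + κ * (b - a) ^ 2 * (c * Real.exp (-(c * t)))

theorem integrableOn_gapBound (hc : 0 ≤ c) (hV : IsProfile F a b c V) (hu : IsOrbit V a b u) :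
    IntegrableOn (gapBound a b c κ V u) (Ioi 0) := by
  refine ((hu.integrableOn_speed hV.pos).const_mul _).add (Integrable.const_mul ?_ _)
  obtain rfl | hc := hc.eq_or_lt
  · simp
  · simpa only [neg_mul] using (exp_neg_integrableOn_Ioi 0 hc).const_mul c

theorem abs_gapIntegrand_le (hF : IsReaction F a b κ) (hc : 0 ≤ c) (hc' : 0 ≤ c')
    (hV : IsProfile F a b c V) (hV' : IsProfile F a b c' V') (hu : IsOrbit V a b u) {t : ℝ}
    (ht : 0 ≤ t) :
    |gapIntegrand c c' V V' u t| ≤ |c' - c| * gapBound a b c κ V u t := by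
  have hut := hu.mem t ht
  have hVpos := hV.pos _ hut
  have hV'pos := hV'.pos _ hut
  have hexp : Real.exp (-(c * t)) ≤ 1 := Real.exp_le_one_iff.2 (by nlinarith)
  have hV'le : V' (u t) ≤ κ * (b - a) := hV'.le_const hF hc' hut
  have hprod : |(c' - c) * (V (u t) * V' (u t))| ≤ |c' - c| * (κ * (b - a) * V (u t)) := by
    rw [abs_mul, abs_of_pos (mul_pos hVpos hV'pos), mul_comm (V (u t))]
    gcongr
  have hsq : |c / 2 * (V' (u t) - V (u t)) ^ 2| ≤ c / 2 * (2 * κ * (b - a) ^ 2 * |c' - c|) := by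
    rw [abs_of_nonneg (by positivity)]
    gcongr
    exact hV.sq_sub_le hV' hF hc hc' hut
  calc |gapIntegrand c c' V V' u t|
      = Real.exp (-(c * t)) *
          |(c' - c) * (V (u t) * V' (u t)) - c / 2 * (V' (u t) - V (u t)) ^ 2| := by
        rw [gapIntegrand, abs_mul, Real.abs_exp]
    _ ≤ Real.exp (-(c * t)) * (|c' - c| * (κ * (b - a) * V (u t)) +
          c / 2 * (2 * κ * (b - a) ^ 2 * |c' - c|)) := by
        gcongr
        exact (abs_sub _ _).trans (add_le_add hprod hsq)
    _ ≤ 1 * (|c' - c| * (κ * (b - a) * V (u t))) +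
          Real.exp (-(c * t)) * (c / 2 * (2 * κ * (b - a) ^ 2 * |c' - c|)) := by
        rw [mul_add]
        gcongr
        exact mul_nonneg (abs_nonneg _) (mul_nonneg (hV'pos.le.trans hV'le) hVpos.le)
    _ = |c' - c| * gapBound a b c κ V u t := by rw [gapBound]; ring

theorem integral_gapIntegrand (hF : IsReaction F a b κ) (hc : 0 ≤ c) (hc' : 0 ≤ c')
    (hV : IsProfile F a b c V) (hV' : IsProfile F a b c' V') (hu : IsOrbit V a b u) :
    ∫ t in Ioi 0, gapIntegrand c c' V V' u t = (V (u 0) ^ 2 - V' (u 0) ^ 2) / 2 := by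
  have hint : IntegrableOn (gapIntegrand c c' V V' u) (Ioi 0) :=
    ((integrableOn_gapBound (κ := κ) hc hV hu).const_mul |c' - c|).mono'
      ((continuousOn_gapIntegrand hV hV' hu).mono Ioi_subset_Ici_self
        |>.aestronglyMeasurable measurableSet_Ioi)
      (ae_restrict_of_forall_mem measurableSet_Ioi fun t ht =>
        abs_gapIntegrand_le hF hc hc' hV hV' hu (le_of_lt ht))
  have hcont : ContinuousOn (fun t => Real.exp (-(c * t)) * ((V' (u t) ^ 2 - V (u t) ^ 2) / 2))
      (Ici 0) :=
    (by fun_prop : Continuous fun t => Real.exp (-(c * t))).continuousOn.mul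
      ((((hV'.continuousOn_comp hu).pow 2).sub ((hV.continuousOn_comp hu).pow 2)).div_const 2)
  have hgap : Tendsto (fun t => (V' (u t) ^ 2 - V (u t) ^ 2) / 2) atTop (𝓝 0) := by
    simpa using (((hV'.tendsto_comp hu.tendsto hu.mem).pow 2).sub
      ((hV.tendsto_comp hu.tendsto hu.mem).pow 2)).div_const 2
  rw [integral_Ioi_of_hasDerivAt_of_tendsto (hcont 0 self_mem_Ici)
    (fun t ht => hasDerivAt_weighted_gap hV hV' hu ht) hint
    (tendsto_exp_neg_mul_mul_zero hc hgap)]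
  simp
  ring

theorem integrableOn_exp_mul_sq (hF : IsReaction F a b κ) (hc : 0 ≤ c)
    (hV : IsProfile F a b c V) (hu : IsOrbit V a b u) :
    IntegrableOn (fun t => Real.exp (-(c * t)) * V (u t) ^ 2) (Ioi 0) := by
  refine ((hu.integrableOn_speed hV.pos).const_mul (κ * (b - a))).mono' ?_
    (ae_restrict_of_forall_mem measurableSet_Ioi fun t ht => ?_)
  · exact (((by fun_prop : Continuous fun t => Real.exp (-(c * t))).continuousOn.mul
      ((hV.continuousOn_comp hu).pow 2)).mono Ioi_subset_Ici_self).aestronglyMeasurable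
        measurableSet_Ioi
  · have hut := hu.mem t (le_of_lt ht)
    have hVpos := hV.pos _ hut
    rw [Real.norm_of_nonneg (by positivity), sq, ← mul_assoc]
    exact mul_le_mul_of_nonneg_right ((mul_le_of_le_one_left hVpos.le (Real.exp_le_one_iff.2
      (neg_nonpos.2 (mul_nonneg hc (le_of_lt ht))))).trans (hV.le_const hF hc hut)) hVpos.le

variable {V : ℝ → ℝ → ℝ}

theorem IsReaction.tendsto_profile_speed (hF : IsReaction F a b κ)
    (hV : ∀ c, 0 ≤ c → IsProfile F a b c (V c)) (hc : 0 ≤ c) {x : ℝ} (hx : x ∈ Ioo a b) :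
    Tendsto (fun c' => V c' x) (𝓝[Ici 0] c) (𝓝 (V c x)) := by
  refine tendsto_iff_norm_sub_tendsto_zero.2 (squeeze_zero' (Eventually.of_forall fun _ =>
    norm_nonneg _) (eventually_mem_nhdsWithin.mono fun c' hc' =>
      (hV c hc).abs_sub_le (hV c' hc') hF hc hc' hx) ?_)
  have : Continuous fun c' => 2 * κ * (b - a) ^ 2 / V c x * |c' - c| := by fun_prop
  simpa using (this.tendsto c).mono_left nhdsWithin_le_nhds

theorem IsReaction.tendsto_sq_sub_div (hF : IsReaction F a b κ)
    (hV : ∀ c, 0 ≤ c → IsProfile F a b c (V c)) (hc : 0 ≤ c) {x : ℝ} (hx : x ∈ Ioo a b) :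
    Tendsto (fun c' => (V c' x - V c x) ^ 2 / (c' - c)) (𝓝[Ici 0] c) (𝓝 0) := by
  refine squeeze_zero_norm' (a := fun c' => (2 * κ * (b - a) ^ 2 / V c x) ^ 2 * |c' - c|)
    (eventually_mem_nhdsWithin.mono fun c' hc' => ?_) ?_
  · rw [norm_div, norm_pow, Real.norm_eq_abs, Real.norm_eq_abs]
    refine div_le_of_le_mul₀ (abs_nonneg _) (by positivity) ?_
    have := pow_le_pow_left₀ (abs_nonneg _) ((hV c hc).abs_sub_le (hV c' hc') hF hc hc' hx) 2
    linarith [mul_pow (2 * κ * (b - a) ^ 2 / V c x) |c' - c| 2]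
  · have : Continuous fun c' => (2 * κ * (b - a) ^ 2 / V c x) ^ 2 * |c' - c| := by fun_prop
    simpa using (this.tendsto c).mono_left nhdsWithin_le_nhds

theorem tendsto_gapIntegrand_div (hF : IsReaction F a b κ)
    (hV : ∀ c, 0 ≤ c → IsProfile F a b c (V c)) (hc : 0 ≤ c) (hu : IsOrbit (V c) a b u) {t : ℝ}
    (ht : 0 ≤ t) :
    Tendsto (fun c' => gapIntegrand c c' (V c) (V c') u t / (c' - c)) (𝓝[Ici 0 \ {c}] c)
      (𝓝 (Real.exp (-(c * t)) * V c (u t) ^ 2)) := by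
  have hut := hu.mem t ht
  have hlim := ((((hF.tendsto_profile_speed hV hc hut).const_mul (V c (u t))).sub
    ((hF.tendsto_sq_sub_div hV hc hut).const_mul (c / 2))).const_mul
      (Real.exp (-(c * t)))).mono_left (nhdsWithin_mono c (sdiff_subset (t := {c})))
  rw [mul_zero, sub_zero, ← sq] at hlim
  refine hlim.congr' (eventually_mem_nhdsWithin.mono fun c' hc' => ?_)
  have hne : c' - c ≠ 0 := sub_ne_zero.2 hc'.2
  simp only [gapIntegrand]
  field_simp

theorem IsReaction.hasDerivWithinAt_sq_profile (hF : IsReaction F a b κ)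
    (hV : ∀ c, 0 ≤ c → IsProfile F a b c (V c)) (hc : 0 ≤ c) (hu : IsOrbit (V c) a b u) :
    HasDerivWithinAt (fun c' => V c' (u 0) ^ 2)
      (-(2 * ∫ t in Ioi 0, Real.exp (-(c * t)) * V c (u t) ^ 2)) (Ici 0) c := by
  have hlim : Tendsto (fun c' => ∫ t in Ioi 0, gapIntegrand c c' (V c) (V c') u t / (c' - c))
      (𝓝[Ici 0 \ {c}] c) (𝓝 (∫ t in Ioi 0, Real.exp (-(c * t)) * V c (u t) ^ 2)) := by
    refine tendsto_integral_filter_of_dominated_convergence (gapBound a b c κ (V c) u) ?_ ?_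
      (integrableOn_gapBound hc (hV c hc) hu)
      (ae_restrict_of_forall_mem measurableSet_Ioi fun t ht =>
        tendsto_gapIntegrand_div hF hV hc hu (le_of_lt ht))
    · filter_upwards [eventually_mem_nhdsWithin] with c' hc'
      exact (((continuousOn_gapIntegrand (hV c hc) (hV c' hc'.1) hu).div_const _).mono
        Ioi_subset_Ici_self).aestronglyMeasurable measurableSet_Ioi
    · filter_upwards [eventually_mem_nhdsWithin] with c' hc'
      refine ae_restrict_of_forall_mem measurableSet_Ioi fun t ht => ?_
      rw [norm_div, Real.norm_eq_abs, Real.norm_eq_abs,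
        div_le_iff₀' (abs_pos.2 (sub_ne_zero.2 hc'.2))]
      exact abs_gapIntegrand_le hF hc hc'.1 (hV c hc) (hV c' hc'.1) hu (le_of_lt ht)
  rw [hasDerivWithinAt_iff_tendsto_slope]
  refine (hlim.const_mul (-2)).congr' (eventually_mem_nhdsWithin.mono fun c' hc' => ?_) |>.trans ?_
  · rw [integral_div, integral_gapIntegrand hF hc hc'.1 (hV c hc) (hV c' hc'.1) hu,
      slope_def_field]
    ring
  · rw [neg_mul]

theorem IsReaction.hasDerivWithinAt_profile (hF : IsReaction F a b κ)
    (hV : ∀ c, 0 ≤ c → IsProfile F a b c (V c)) (hc : 0 ≤ c) (hu : IsOrbit (V c) a b u) :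
    HasDerivWithinAt (fun c' => V c' (u 0))
      (-(1 / V c (u 0)) * ∫ t in Ioi 0, Real.exp (-(c * t)) * V c (u t) ^ 2) (Ici 0) c := by
  have hx := hu.mem 0 le_rfl
  have hpos := (hV c hc).pos _ hx
  refine (((hF.hasDerivWithinAt_sq_profile hV hc hu).sqrt (by positivity)).congr
    (fun c' hc' => (Real.sqrt_sq ((hV c' hc').pos _ hx).le).symm)
    (Real.sqrt_sq hpos.le).symm).congr_deriv ?_
  rw [Real.sqrt_sq hpos.le]
  field_simp

end SpeedDependence

section Trajectory

/-- The reaction term `F`, positive on `(a, b)`, lives on the open set `W ⊇ [a, b]`, where `b` is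
its only zero. Trajectories of `X_c` in the strip `W × ℝ` may a priori go beyond `b`. -/
structure IsReactionStrip (F : ℝ → ℝ) (W : Set ℝ) (a b κ : ℝ) : Prop
    extends IsReaction F a b κ where
  isOpen : IsOpen W
  continuousOn_strip : ContinuousOn F W
  Icc_subset : Icc a b ⊆ W
  zero_iff : ∀ x ∈ W, F x = 0 ↔ x = b

variable {F V u : ℝ → ℝ} {W : Set ℝ} {a b c κ : ℝ} {γ : ℝ → ℝ × ℝ}

theorem IsReactionStrip.hasDerivAt_integral (hS : IsReactionStrip F W a b κ) {x : ℝ}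
    (hx : uIcc b x ⊆ W) : HasDerivAt (fun x => ∫ y in b..x, F y) (F x) x := by
  have hxW : x ∈ W := hx right_mem_uIcc
  exact intervalIntegral.integral_hasDerivAt_right
    (hS.continuousOn_strip.mono hx).intervalIntegrable
    (hS.continuousOn_strip.stronglyMeasurableAtFilter hS.isOpen x hxW)
    (hS.continuousOn_strip.continuousAt (hS.isOpen.mem_nhds hxW))

theorem IsReactionStrip.neg_integral_le (hS : IsReactionStrip F W a b κ) {x : ℝ}
    (hx : x ∈ Icc a b) : -(2 * ∫ y in b..x, F y) ≤ (κ * (b - x)) ^ 2 := by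
  have hΦ : ∀ x ∈ Icc a b, HasDerivAt (fun x => ∫ y in b..x, F y) (F x) x := fun x hx =>
    hS.hasDerivAt_integral ((uIcc_of_ge hx.2).subset.trans
      ((Icc_subset_Icc_left hx.1).trans hS.Icc_subset))
  exact hS.le_parabola (P := fun x => -(2 * ∫ y in b..x, F y))
    (fun x hx => ((hΦ x hx).const_mul 2).neg.continuousAt.continuousWithinAt) (by simp)
    (fun x hx => ⟨_, le_rfl, ((hΦ x (Ioo_subset_Icc_self hx)).const_mul 2).neg⟩) x hx

namespace IsForwardTrajectory

theorem hasDerivWithinAt_fst (hγ : IsForwardTrajectory F W c γ) {t : ℝ} (ht : 0 ≤ t) :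
    HasDerivWithinAt (fun t => (γ t).1) (γ t).2 (Ici 0) t :=
  (hγ.ode t ht).fst

theorem hasDerivWithinAt_snd (hγ : IsForwardTrajectory F W c γ) {t : ℝ} (ht : 0 ≤ t) :
    HasDerivWithinAt (fun t => (γ t).2) (c * (γ t).2 - F (γ t).1) (Ici 0) t :=
  (hγ.ode t ht).snd

theorem continuousOn_fst (hγ : IsForwardTrajectory F W c γ) :
    ContinuousOn (fun t => (γ t).1) (Ici 0) := fun _ ht =>
  (hγ.hasDerivWithinAt_fst ht).continuousWithinAt

theorem shift (hγ : IsForwardTrajectory F W c γ) {τ : ℝ} (hτ : 0 ≤ τ) :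
    IsForwardTrajectory F W c (fun t => γ (t + τ)) where
  mem t ht := hγ.mem _ (add_nonneg ht hτ)
  ode t ht := by
    have hshift : HasDerivWithinAt (fun t => t + τ) 1 (Ici 0) t :=
      ((hasDerivAt_id t).add_const τ).hasDerivWithinAt
    simpa [Function.comp_def] using (hγ.ode (t + τ) (add_nonneg ht hτ)).scomp t hshift
      fun s hs => add_nonneg hs hτ

theorem uIcc_subset (hγ : IsForwardTrajectory F W c γ) {v : ℝ}
    (hlim : Tendsto γ atTop (𝓝 (b, v))) (hb : b ∈ W) {t : ℝ} (ht : 0 ≤ t) :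
    uIcc b (γ t).1 ⊆ W := by
  set R : Set ℝ := (fun t => (γ t).1) '' Ici 0
  have hR : IsPreconnected R := isPreconnected_Ici.image _ hγ.continuousOn_fst
  have hbR : b ∈ closure R := mem_closure_of_tendsto hlim.fst_nhds
    ((eventually_ge_atTop 0).mono fun s hs => mem_image_of_mem _ hs)
  have hins : (insert b R).OrdConnected := (hR.subset_closure (subset_insert b R)
    (insert_subset hbR subset_closure)).ordConnected
  refine (hins.uIcc_subset (mem_insert b R) (mem_insert_of_mem b ⟨t, ht, rfl⟩)).trans
    (insert_subset hb ?_)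
  rintro _ ⟨s, hs, rfl⟩
  exact hγ.mem s hs

theorem sq_snd_le (hγ : IsForwardTrajectory F W c γ) (hlim : Tendsto γ atTop (𝓝 (b, 0)))
    (hS : IsReactionStrip F W a b κ) (hc : 0 ≤ c) {t : ℝ} (ht : 0 ≤ t)
    (hu : (γ t).1 ∈ Icc a b) : (γ t).2 ^ 2 ≤ (κ * (b - (γ t).1)) ^ 2 := by
  have hb : b ∈ W := hS.Icc_subset ⟨hS.lt.le, le_rfl⟩
  -- Twice the mechanical energy: it grows at the rate `2 c v²` and tends to `0`.
  set E : ℝ → ℝ := fun t => (γ t).2 ^ 2 + 2 * ∫ y in b..(γ t).1, F y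
  have hE : ∀ s ∈ Ici (0 : ℝ), HasDerivWithinAt E (2 * (c * (γ s).2 ^ 2)) (Ici 0) s :=
    fun s hs => by
      refine (((hγ.hasDerivWithinAt_snd hs).pow 2).add (((hS.hasDerivAt_integral
        (hγ.uIcc_subset hlim hb hs)).comp_hasDerivWithinAt s
          (hγ.hasDerivWithinAt_fst hs)).const_mul 2)).congr_deriv ?_
      simp
      ring
  have hEmono : MonotoneOn E (Ici 0) :=
    monotoneOn_of_hasDerivWithinAt_nonneg (convex_Ici 0)
      (fun s hs => (hE s hs).continuousWithinAt)
      (fun s hs => (hE s (interior_subset hs)).mono interior_subset)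
      fun s _ => by positivity
  have hElim : Tendsto E atTop (𝓝 0) := by
    have hΦ := (hS.hasDerivAt_integral (x := b) (by simpa using hb)).continuousAt.tendsto
    simpa using (hlim.snd_nhds.pow 2).add ((hΦ.comp hlim.fst_nhds).const_mul 2)
  have hE0 : E t ≤ 0 := le_of_monotoneOn_of_tendsto hEmono hElim ht
  linarith [hS.neg_integral_le hu]

theorem fst_lt (hγ : IsForwardTrajectory F W c γ) (hlim : Tendsto γ atTop (𝓝 (b, 0)))
    (hS : IsReactionStrip F W a b κ) (hc : 0 ≤ c) (h0 : (γ 0).1 < b) {t : ℝ} (ht : 0 ≤ t) :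
    (γ t).1 < b := by
  by_contra! hbt
  obtain ⟨s, hs, hsb, hbefore⟩ :=
    exists_first_hitting (hγ.continuousOn_fst.mono Icc_subset_Ici_self) ht h0 hbt
  obtain ⟨r, hr, hrs⟩ : ∃ r ∈ Ico 0 s, ∀ q ∈ Icc r s, (γ q).1 ∈ Icc a b := by
    have hnear : ∀ᶠ q in 𝓝 s, 0 ≤ q ∧ a < (γ q).1 := (eventually_ge_nhds hs.1).and
      ((hγ.continuousOn_fst.continuousAt (Ici_mem_nhds hs.1)).tendsto.eventually_const_lt
        (hsb ▸ hS.lt))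
    obtain ⟨r, hr, hrs⟩ := mem_nhdsLE_iff_exists_Icc_subset.1 (mem_nhdsWithin_of_mem_nhds hnear)
    refine ⟨r, ⟨(hrs ⟨le_rfl, le_of_lt hr⟩).1, hr⟩, fun q hq => ⟨(hrs hq).2.le, ?_⟩⟩
    obtain hqs | rfl := hq.2.lt_or_eq
    · exact (hbefore q ⟨(hrs hq).1, hqs⟩).le
    · exact hsb.le
  have hsub : Icc r s ⊆ Ici 0 := fun q hq => hr.1.trans hq.1
  have hmono : MonotoneOn (fun q => (b - (γ q).1) * Real.exp (κ * q)) (Icc r s) := by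
    refine monotoneOn_of_hasDerivWithinAt_nonneg (convex_Icc r s) ?_ ?_ ?_
      (f' := fun q => (κ * (b - (γ q).1) - (γ q).2) * Real.exp (κ * q))
    · exact ((continuousOn_const.sub hγ.continuousOn_fst).mul
        (by fun_prop : Continuous fun q => Real.exp (κ * q)).continuousOn).mono hsub
    · intro q hq
      have hexp : HasDerivAt (fun q => Real.exp (κ * q)) (Real.exp (κ * q) * κ) q := by
        simpa using ((hasDerivAt_id q).const_mul κ).exp
      refine ((((hγ.hasDerivWithinAt_fst (hsub (interior_subset hq))).mono
        (interior_subset.trans hsub)).const_sub b).mul hexp.hasDerivWithinAt).congr_deriv ?_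
      ring
    · intro q hq
      have hq' := interior_subset hq
      refine mul_nonneg (sub_nonneg.2 (le_of_sq_le_sq
        (hγ.sq_snd_le hlim hS hc (hsub hq') (hrs q hq')) ?_)) (Real.exp_pos _).le
      exact mul_nonneg hS.nonneg (sub_nonneg.2 (hrs q hq').2)
  have hle := hmono ⟨le_rfl, hr.2.le⟩ ⟨hr.2.le, le_rfl⟩ hr.2.le
  have : 0 < (b - (γ r).1) * Real.exp (κ * r) :=
    mul_pos (sub_pos.2 (hbefore r hr)) (Real.exp_pos _)
  simp only [hsb, sub_self, zero_mul] at hle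
  linarith

theorem reaction_pos (hγ : IsForwardTrajectory F W c γ) (hlim : Tendsto γ atTop (𝓝 (b, 0)))
    (hS : IsReactionStrip F W a b κ) (hc : 0 ≤ c) (h0 : (γ 0).1 ∈ Ioo a b) {t : ℝ}
    (ht : 0 ≤ t) : 0 < F (γ t).1 :=
  isPreconnected_Ici.lt_of_ne (hS.continuousOn_strip.comp hγ.continuousOn_fst hγ.mem)
    (fun s hs hFs => (hγ.fst_lt hlim hS hc h0.2 hs).ne ((hS.zero_iff _ (hγ.mem s hs)).1 hFs))
    ⟨0, self_mem_Ici, hS.pos _ h0⟩ ht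

theorem snd_pos (hγ : IsForwardTrajectory F W c γ) (hlim : Tendsto γ atTop (𝓝 (b, 0)))
    (hS : IsReactionStrip F W a b κ) (hc : 0 ≤ c) (h0 : (γ 0).1 ∈ Ioo a b) {t : ℝ}
    (ht : 0 ≤ t) : 0 < (γ t).2 := by
  set w : ℝ → ℝ := fun t => Real.exp (-(c * t)) * (γ t).2
  have hw : ∀ s ∈ Ici (0 : ℝ),
      HasDerivWithinAt w (-(Real.exp (-(c * s)) * F (γ s).1)) (Ici 0) s := fun s hs => by
    have hexp : HasDerivAt (fun t => Real.exp (-(c * t))) (Real.exp (-(c * s)) * -c) s := by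
      simpa using ((hasDerivAt_id s).const_mul c).neg.exp
    refine (hexp.hasDerivWithinAt.mul (hγ.hasDerivWithinAt_snd hs)).congr_deriv ?_
    ring
  have hanti : StrictAntiOn w (Ici 0) :=
    strictAntiOn_of_hasDerivWithinAt_neg (convex_Ici 0)
      (fun s hs => (hw s hs).continuousWithinAt)
      (fun s hs => (hw s (interior_subset hs)).mono interior_subset)
      fun s hs => neg_neg_iff_pos.2 (mul_pos (Real.exp_pos _)
        (hγ.reaction_pos hlim hS hc h0 (interior_subset hs)))
  have hwlim : Tendsto w atTop (𝓝 0) := tendsto_exp_neg_mul_mul_zero hc hlim.snd_nhds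
  have hw1 : 0 ≤ w (t + 1) := by
    simpa using le_of_monotoneOn_of_tendsto hanti.antitoneOn.neg hwlim.neg
      (by positivity : 0 ≤ t + 1)
  have hwt : 0 < w t := hw1.trans_lt (hanti ht (by positivity : 0 ≤ t + 1) (lt_add_one t))
  exact pos_of_mul_pos_right hwt (Real.exp_pos _).le

theorem fst_mem_Ioo (hγ : IsForwardTrajectory F W c γ) (hlim : Tendsto γ atTop (𝓝 (b, 0)))
    (hS : IsReactionStrip F W a b κ) (hc : 0 ≤ c) (h0 : (γ 0).1 ∈ Ioo a b) {t : ℝ}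
    (ht : 0 ≤ t) : (γ t).1 ∈ Ioo a b := by
  have hmono : MonotoneOn (fun t => (γ t).1) (Ici 0) :=
    monotoneOn_of_hasDerivWithinAt_nonneg (convex_Ici 0) hγ.continuousOn_fst
      (fun s hs => (hγ.hasDerivWithinAt_fst (interior_subset hs)).mono interior_subset)
      fun s hs => (hγ.snd_pos hlim hS hc h0 (interior_subset hs)).le
  exact ⟨h0.1.trans_le (hmono self_mem_Ici ht ht), hγ.fst_lt hlim hS hc h0.2 ht⟩

theorem snd_eq_profile (hγ : IsForwardTrajectory F W c γ) (hlim : Tendsto γ atTop (𝓝 (b, 0)))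
    (hS : IsReactionStrip F W a b κ) (hc : 0 ≤ c) (hV : IsProfile F a b c V)
    (h0 : (γ 0).1 ∈ Ioo a b) {t : ℝ} (ht : 0 ≤ t) : (γ t).2 = V (γ t).1 := by
  have hmem : ∀ s, 0 ≤ s → (γ s).1 ∈ Ioo a b := fun s hs => hγ.fst_mem_Ioo hlim hS hc h0 hs
  set D : ℝ → ℝ := fun t => ((γ t).2 - V (γ t).1) ^ 2
  have hD : ∀ s ∈ Ici (0 : ℝ),
      HasDerivWithinAt D (2 * (F (γ s).1 / V (γ s).1) * D s) (Ici 0) s := fun s hs => by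
    have hVs := hV.pos _ (hmem s hs)
    refine (((hγ.hasDerivWithinAt_snd hs).sub ((hV.hasDerivAt _ (hmem s hs)).comp_hasDerivWithinAt
      s (hγ.hasDerivWithinAt_fst hs))).pow 2).congr_deriv ?_
    simp [D]
    field_simp
    ring
  have hDmono : MonotoneOn D (Ici 0) :=
    monotoneOn_of_hasDerivWithinAt_nonneg (convex_Ici 0)
      (fun s hs => (hD s hs).continuousWithinAt)
      (fun s hs => (hD s (interior_subset hs)).mono interior_subset)
      fun s hs => by
        have hs' := hmem s (interior_subset hs)
        have := hS.pos _ hs'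
        have := hV.pos _ hs'
        positivity
  have hDlim : Tendsto D atTop (𝓝 0) := by
    simpa using (hlim.snd_nhds.sub (hV.tendsto_comp hlim.fst_nhds hmem)).pow 2
  have hD0 : D t = 0 :=
    (le_of_monotoneOn_of_tendsto hDmono hDlim ht).antisymm (sq_nonneg _)
  exact sub_eq_zero.1 (pow_eq_zero_iff two_ne_zero |>.1 hD0)

theorem isOrbit (hγ : IsForwardTrajectory F W c γ) (hlim : Tendsto γ atTop (𝓝 (b, 0)))
    (hS : IsReactionStrip F W a b κ) (hc : 0 ≤ c) (hV : IsProfile F a b c V)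
    (h0 : (γ 0).1 ∈ Ioo a b) : IsOrbit V a b (fun t => (γ t).1) where
  mem _ ht := hγ.fst_mem_Ioo hlim hS hc h0 ht
  hasDerivWithinAt _ ht := hγ.snd_eq_profile hlim hS hc hV h0 ht ▸ hγ.hasDerivWithinAt_fst ht
  tendsto := hlim.fst_nhds

end IsForwardTrajectory

theorem IsOrbit.isForwardTrajectory (hu : IsOrbit V a b u) (hV : IsProfile F a b c V)
    (hW : Icc a b ⊆ W) : IsForwardTrajectory F W c (fun t => (u t, V (u t))) where
  mem t ht := hW (Ioo_subset_Icc_self (hu.mem t ht))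
  ode t ht := by
    have hut := hu.mem t ht
    have := hV.pos _ hut
    refine ((hu.hasDerivWithinAt t ht).prodMk ((hV.hasDerivAt _ hut).comp_hasDerivWithinAt t
      (hu.hasDerivWithinAt t ht))).congr_deriv ?_
    simp only [field, Prod.mk.injEq, true_and]
    field_simp

end Trajectory

section Height

variable {F : ℝ → ℝ} {W : Set ℝ} {a b c κ θ x y : ℝ} {γ : ℝ → ℝ × ℝ}

section FixedSpeed

variable {V : ℝ → ℝ}

theorem IsReactionStrip.exists_isForwardTrajectory (hS : IsReactionStrip F W a b κ) (hc : 0 ≤ c)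
    (hV : IsProfile F a b c V) (hx : x ∈ Ioc a b) :
    ∃ γ, IsForwardTrajectory F W c γ ∧ γ 0 = (x, V x) ∧ Tendsto γ atTop (𝓝 (b, 0)) := by
  obtain hxb | rfl := hx.2.lt_or_eq
  · obtain ⟨u, hu0, hu⟩ := exists_isOrbit (hV.continuousOn.mono Ioo_subset_Icc_self) hV.pos
      (fun y hy => hV.le hS.toIsReaction hc (Ioo_subset_Icc_self hy)) ⟨hx.1, hxb⟩
    exact ⟨_, hu.isForwardTrajectory hV hS.Icc_subset, by rw [hu0],
      hu.tendsto.prodMk_nhds (hV.tendsto_comp hu.tendsto hu.mem)⟩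
  · have hxW : x ∈ W := hS.Icc_subset ⟨hS.lt.le, le_rfl⟩
    refine ⟨fun _ => (x, 0), ⟨fun _ _ => hxW, fun t _ => ?_⟩, by rw [hV.right_eq],
      tendsto_const_nhds⟩
    simpa [field, (hS.zero_iff x hxW).2 rfl, Prod.mk_zero_zero] using
      hasDerivWithinAt_const t (Ici 0) ((x, 0) : ℝ × ℝ)

theorem IsReactionStrip.mem_stableSeparatrix_iff (hS : IsReactionStrip F W a b κ) (hc : 0 ≤ c)
    (hV : IsProfile F a b c V) (hθ : a < θ) :
    (x, y) ∈ stableSeparatrix F W θ b c ↔ x ∈ Icc θ b ∧ y = V x := by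
  constructor
  · rintro ⟨⟨γ, hγ, h0, hlim⟩, hx, -⟩
    refine ⟨hx, ?_⟩
    obtain hxb | rfl := hx.2.lt_or_eq
    · simpa [h0] using
        hγ.snd_eq_profile hlim hS hc hV (by simpa [h0] using ⟨hθ.trans_le hx.1, hxb⟩) le_rfl
    · have hy : y ^ 2 ≤ 0 := by
        simpa [h0] using hγ.sq_snd_le hlim hS hc le_rfl (by simpa [h0] using hS.lt.le)
      rw [hV.right_eq]
      exact pow_eq_zero_iff two_ne_zero |>.1 (hy.antisymm (sq_nonneg y))
  · rintro ⟨hx, rfl⟩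
    refine ⟨hS.exists_isForwardTrajectory hc hV ⟨hθ.trans_le hx.1, hx.2⟩, hx, ?_⟩
    obtain hxb | rfl := hx.2.lt_or_eq
    · exact (hV.pos x ⟨hθ.trans_le hx.1, hxb⟩).le
    · exact hV.right_eq.ge

theorem IsReactionStrip.height_eq (hS : IsReactionStrip F W a b κ) (hc : 0 ≤ c)
    (hV : IsProfile F a b c V) (hθ : a < θ) (hx : x ∈ Icc θ b) : height F W θ b x c = V x := by
  simp [height, hS.mem_stableSeparatrix_iff hc hV hθ, hx.1, hx.2]

end FixedSpeed

theorem IsReactionStrip.stableSeparatrix_eq_graph (hS : IsReactionStrip F W a b κ) (hc : 0 ≤ c)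
    (hθ : a < θ) :
    stableSeparatrix F W θ b c = {p | p.1 ∈ Icc θ b ∧ p.2 = height F W θ b p.1 c} := by
  obtain ⟨V, hV⟩ := hS.exists_isProfile hc
  ext ⟨x, y⟩
  rw [hS.mem_stableSeparatrix_iff hc hV hθ]
  exact and_congr_right fun hx => by rw [hS.height_eq hc hV hθ hx]

theorem IsReactionStrip.height_pos (hS : IsReactionStrip F W a b κ) (hc : 0 ≤ c) (hθ : a < θ)
    (hx : x ∈ Ico θ b) : 0 < height F W θ b x c := by
  obtain ⟨V, hV⟩ := hS.exists_isProfile hc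
  rw [hS.height_eq hc hV hθ (Ico_subset_Icc_self hx)]
  exact hV.pos x ⟨hθ.trans_le hx.1, hx.2⟩

theorem IsReactionStrip.exists_trajectory_height (hS : IsReactionStrip F W a b κ) (hc : 0 ≤ c)
    (hθ : a < θ) (hx : x ∈ Icc θ b) :
    ∃ γ, IsForwardTrajectory F W c γ ∧ γ 0 = (x, height F W θ b x c) ∧
      Tendsto γ atTop (𝓝 (b, 0)) := by
  obtain ⟨V, hV⟩ := hS.exists_isProfile hc
  rw [hS.height_eq hc hV hθ hx]
  exact hS.exists_isForwardTrajectory hc hV ⟨hθ.trans_le hx.1, hx.2⟩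

theorem IsForwardTrajectory.existsUnique_time (hγ : IsForwardTrajectory F W c γ)
    (hlim : Tendsto γ atTop (𝓝 (b, 0))) (hS : IsReactionStrip F W a b κ) (hc : 0 ≤ c)
    (h0 : a < (γ 0).1) (hx : x ∈ Ico (γ 0).1 b) : ∃! τ, 0 ≤ τ ∧ (γ τ).1 = x := by
  obtain ⟨V, hV⟩ := hS.exists_isProfile hc
  exact (hγ.isOrbit hlim hS hc hV ⟨h0, hx.1.trans_lt hx.2⟩).existsUnique_time hV.pos hx

theorem IsForwardTrajectory.integrableOn_exp_mul_sq_snd (hγ : IsForwardTrajectory F W c γ)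
    (hlim : Tendsto γ atTop (𝓝 (b, 0))) (hS : IsReactionStrip F W a b κ) (hc : 0 ≤ c)
    (h0 : (γ 0).1 ∈ Ioo a b) :
    IntegrableOn (fun t => Real.exp (-(c * t)) * (γ t).2 ^ 2) (Ioi 0) := by
  obtain ⟨V, hV⟩ := hS.exists_isProfile hc
  refine (integrableOn_exp_mul_sq hS.toIsReaction hc hV
    (hγ.isOrbit hlim hS hc hV h0)).congr_fun (fun t ht => ?_) measurableSet_Ioi
  simp only [hγ.snd_eq_profile hlim hS hc hV h0 (le_of_lt ht)]

theorem IsForwardTrajectory.integral_exp_mul_sq_snd_pos (hγ : IsForwardTrajectory F W c γ)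
    (hlim : Tendsto γ atTop (𝓝 (b, 0))) (hS : IsReactionStrip F W a b κ) (hc : 0 ≤ c)
    (h0 : (γ 0).1 ∈ Ioo a b) : 0 < ∫ t in Ioi 0, Real.exp (-(c * t)) * (γ t).2 ^ 2 := by
  have hpos : Ioi 0 ⊆ Function.support fun t => Real.exp (-(c * t)) * (γ t).2 ^ 2 := fun t ht =>
    (mul_pos (Real.exp_pos _) (pow_pos (hγ.snd_pos hlim hS hc h0 (le_of_lt ht)) 2)).ne'
  rw [setIntegral_pos_iff_support_of_nonneg_ae (Eventually.of_forall fun t => by positivity)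
    (hγ.integrableOn_exp_mul_sq_snd hlim hS hc h0), inter_eq_right.2 hpos, Real.volume_Ioi]
  exact ENNReal.zero_lt_top

theorem IsForwardTrajectory.hasDerivWithinAt_height (hγ : IsForwardTrajectory F W c γ)
    (hlim : Tendsto γ atTop (𝓝 (b, 0))) (hS : IsReactionStrip F W a b κ) (hc : 0 ≤ c)
    (hθ : a < θ) (hx : x ∈ Ico θ b) (h0 : (γ 0).1 = x) :
    HasDerivWithinAt (fun c' => height F W θ b x c')
      (-(1 / height F W θ b x c) * ∫ t in Ioi 0, Real.exp (-(c * t)) * (γ t).2 ^ 2)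
      (Ici 0) c := by
  subst h0
  have h0 : (γ 0).1 ∈ Ioo a b := ⟨hθ.trans_le hx.1, hx.2⟩
  choose! V hV using fun c (hc : 0 ≤ c) => hS.exists_isProfile hc
  have hheight : ∀ c', 0 ≤ c' → height F W θ b (γ 0).1 c' = V c' (γ 0).1 := fun c' hc' =>
    hS.height_eq hc' (hV c' hc') hθ (Ico_subset_Icc_self hx)
  refine ((hS.hasDerivWithinAt_profile hV hc (hγ.isOrbit hlim hS hc (hV c hc) h0)).congr hheight
    (hheight c hc)).congr_deriv ?_
  rw [hheight c hc]
  congr 1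
  exact setIntegral_congr_fun measurableSet_Ioi fun t ht => by
    simp only [hγ.snd_eq_profile hlim hS hc (hV c hc) h0 (le_of_lt ht)]

theorem IsReactionStrip.derivWithin_height_neg (hS : IsReactionStrip F W a b κ) (hc : 0 ≤ c)
    (hθ : a < θ) (hx : x ∈ Ico θ b) :
    derivWithin (fun c' => height F W θ b x c') (Ici 0) c < 0 := by
  obtain ⟨γ, hγ, h0, hlim⟩ := hS.exists_trajectory_height hc hθ (Ico_subset_Icc_self hx)
  have h0x : (γ 0).1 = x := congrArg Prod.fst h0
  rw [(hγ.hasDerivWithinAt_height hlim hS hc hθ hx h0x).derivWithin (uniqueDiffOn_Ici 0 c hc),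
    neg_mul, neg_lt_zero]
  exact mul_pos (one_div_pos.2 (hS.height_pos hc hθ hx))
    (hγ.integral_exp_mul_sq_snd_pos hlim hS hc (h0x ▸ ⟨hθ.trans_le hx.1, hx.2⟩))

end Height

section Construction

variable {F : ℝ → ℝ} {W : Set ℝ} {a b θ : ℝ}

theorem exists_Icc_subset_of_isOpen (hW : IsOpen W) (hab : a ≤ b) (hsub : Icc a b ⊆ W) :
    ∃ a' < a, Icc a' b ⊆ W := by
  obtain ⟨a', ha', hsub'⟩ := mem_nhdsLE_iff_exists_Icc_subset.1
    (mem_nhdsWithin_of_mem_nhds (hW.mem_nhds (hsub ⟨le_rfl, hab⟩)))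
  refine ⟨a', ha', ?_⟩
  rw [← Icc_union_Icc_eq_Icc (le_of_lt ha') hab]
  exact union_subset hsub' hsub

theorem exists_norm_sub_le_mul_norm_sub {E : Type*} [NormedAddCommGroup E] [NormedSpace ℝ E]
    {f : ℝ → E} {K : Set ℝ} (hK : IsCompact K) (hKW : K ⊆ W) (hW : W ∈ 𝓝 b)
    (hf : ContinuousOn f W) (hd : DifferentiableAt ℝ f b) :
    ∃ C, 0 ≤ C ∧ ∀ x ∈ K, ‖f x - f b‖ ≤ C * ‖x - b‖ := by
  obtain ⟨C, hC⟩ :=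
    hK.exists_bound_of_continuousOn (((continuousOn_dslope hW).2 ⟨hf, hd⟩).mono hKW)
  refine ⟨max C 0, le_max_right _ _, fun x hx => ?_⟩
  rw [← sub_smul_dslope, norm_smul, mul_comm]
  exact mul_le_mul_of_nonneg_right ((hC x hx).trans (le_max_left _ _)) (norm_nonneg _)

theorem exists_isReactionStrip (hθ : θ < b) (hW : IsOpen W) (hIW : Icc θ b ⊆ W)
    (hF : ContinuousOn F W) (hzero : ∀ x ∈ W, F x = 0 ↔ x = b) (hpos : 0 < F θ)
    (hd : DifferentiableAt ℝ F b) : ∃ a < θ, ∃ κ, IsReactionStrip F W a b κ := by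
  obtain ⟨a, ha, haW⟩ := exists_Icc_subset_of_isOpen hW hθ.le hIW
  have hab : a < b := ha.trans hθ
  have hFab : ContinuousOn F (Icc a b) := hF.mono haW
  have hbW : b ∈ W := hIW ⟨hθ.le, le_rfl⟩
  obtain ⟨C, hC0, hC⟩ :=
    exists_norm_sub_le_mul_norm_sub isCompact_Icc haW (hW.mem_nhds hbW) hF hd
  exact ⟨a, ha, √C,
    { lt := hab
      nonneg := Real.sqrt_nonneg C
      continuousOn := hFab
      pos := fun x hx => isPreconnected_Ioo.lt_of_ne (hFab.mono Ioo_subset_Icc_self)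
        (fun y hy hFy => hy.2.ne ((hzero y (haW (Ioo_subset_Icc_self hy))).1 hFy))
        ⟨θ, ⟨ha, hθ⟩, hpos⟩ hx
      le := fun x hx => by
        rw [Real.sq_sqrt hC0, ← abs_of_nonneg (sub_nonneg.2 hx.2), abs_sub_comm]
        simpa [(hzero b hbW).2 rfl] using (le_abs_self _).trans (hC x hx)
      isOpen := hW
      continuousOn_strip := hF
      Icc_subset := haW
      zero_iff := hzero }⟩

theorem pos_of_deriv_neg_of_zero_iff (hθ : θ < b) (hIW : Icc θ b ⊆ W) (hF : ContinuousOn F W)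
    (hzero : ∀ x ∈ W, F x = 0 ↔ x = b) (hd : deriv F b < 0) : 0 < F θ := by
  have hb : F b = 0 := (hzero b (hIW ⟨hθ.le, le_rfl⟩)).2 rfl
  have hne : ∀ x ∈ Ico θ b, F x ≠ 0 := fun x hx hFx =>
    hx.2.ne ((hzero x (hIW (Ico_subset_Icc_self hx))).1 hFx)
  obtain ⟨x, hx, hFx⟩ : ∃ x ∈ Ico θ b, 0 < F x := by
    have hsign : ∀ᶠ x in 𝓝[<] b, SignType.sign (F x) = SignType.sign (b - x) :=
      (eventually_nhdsWithin_sign_eq_of_deriv_neg hd hb).filter_mono nhdsWithin_le_nhds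
    obtain ⟨x, hx, hxI⟩ := (hsign.and (Ico_mem_nhdsLT hθ)).exists
    exact ⟨x, hxI, by rwa [sign_pos (sub_pos.2 hxI.2), sign_eq_one_iff] at hx⟩
  exact isPreconnected_Ico.lt_of_ne (hF.mono (Ico_subset_Icc_self.trans hIW)) hne ⟨x, hx, hFx⟩
    ⟨le_rfl, hθ⟩

end Construction

end Separatrix

theorem proposition4p3_general (F : ℝ → ℝ) (W : Set ℝ) (θhl θp : ℝ)
    (hθ : θhl < θp) (hW : IsOpen W) (hIW : Icc θhl θp ⊆ W)
    (hF : ContinuousOn F W) (hd : DifferentiableAt ℝ F θp)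
    (hzero : ∀ x ∈ W, F x = 0 ↔ x = θp) (hpos : 0 < F θhl) :
    (∀ c : ℝ, 0 ≤ c →
      Separatrix.stableSeparatrix F W θhl θp c =
        {p : ℝ × ℝ | p.1 ∈ Icc θhl θp ∧ p.2 = Separatrix.height F W θhl θp p.1 c} ∧
      ∃ γ : ℝ → ℝ × ℝ, Separatrix.IsSeparatrixTrajectory F W θhl θp c γ) ∧
    ∀ u ∈ Ico θhl θp, ∀ c : ℝ, 0 ≤ c →
      0 < Separatrix.height F W θhl θp u c ∧
      derivWithin (fun c' => Separatrix.height F W θhl θp u c') (Ici 0) c < 0 ∧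
      ∀ γ : ℝ → ℝ × ℝ, Separatrix.IsSeparatrixTrajectory F W θhl θp c γ →
        (∃! τ : ℝ, 0 ≤ τ ∧ (γ τ).1 = u) ∧
        ∀ τ : ℝ, 0 ≤ τ → (γ τ).1 = u →
          IntegrableOn (fun t => Real.exp (-(c * t)) * (γ (t + τ)).2 ^ 2) (Ioi 0) ∧
          HasDerivWithinAt (fun c' => Separatrix.height F W θhl θp u c')
            (-(1 / Separatrix.height F W θhl θp u c) *
              ∫ t in Ioi (0 : ℝ), Real.exp (-(c * t)) * (γ (t + τ)).2 ^ 2)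
            (Ici 0) c := by
  obtain ⟨a, ha, κ, hS⟩ := Separatrix.exists_isReactionStrip hθ hW hIW hF hzero hpos hd
  refine ⟨fun c hc => ⟨hS.stableSeparatrix_eq_graph hc ha, ?_⟩, fun u hu c hc =>
    ⟨hS.height_pos hc ha hu, hS.derivWithin_height_neg hc ha hu, fun γ hγ => ⟨?_, ?_⟩⟩⟩
  · obtain ⟨γ, hγ, h0, hlim⟩ := hS.exists_trajectory_height hc ha (left_mem_Icc.2 hθ.le)
    exact ⟨γ, hγ, h0, hlim⟩
  · have h0 : (γ 0).1 = θhl := congrArg Prod.fst hγ.init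
    exact hγ.traj.existsUnique_time hγ.lim hS hc (h0 ▸ ha) (h0 ▸ hu)
  · intro τ hτ hτu
    have hlim : Tendsto (fun t => γ (t + τ)) atTop (𝓝 (θp, 0)) :=
      hγ.lim.comp (tendsto_atTop_add_const_right _ τ tendsto_id)
    have h0 : (γ (0 + τ)).1 = u := by rwa [zero_add]
    exact ⟨(hγ.traj.shift hτ).integrableOn_exp_mul_sq_snd hlim hS hc
        (h0 ▸ ⟨ha.trans_le hu.1, hu.2⟩),
      (hγ.traj.shift hτ).hasDerivWithinAt_height hlim hS hc ha hu h0⟩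

theorem proposition4p3 (F : ℝ → ℝ) (W : Set ℝ) (θhl θp : ℝ)
    (hθ : θhl < θp) (hW : IsOpen W) (hIW : Icc θhl θp ⊆ W)
    (hF : ContDiffOn ℝ ∞ F W)
    (hzero : ∀ x ∈ W, F x = 0 ↔ x = θp)
    (hF' : deriv F θp < 0) :
    -- for each `c ≥ 0`, the separatrix is the graph of `v(·, c)` over `[θhl, θp]`,
    -- and the trajectory `γ_c` exists
    (∀ c : ℝ, 0 ≤ c →
      Separatrix.stableSeparatrix F W θhl θp c =
        {p : ℝ × ℝ | p.1 ∈ Icc θhl θp ∧ p.2 = Separatrix.height F W θhl θp p.1 c} ∧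
      ∃ γ : ℝ → ℝ × ℝ, Separatrix.IsSeparatrixTrajectory F W θhl θp c γ) ∧
    ∀ u ∈ Ico θhl θp, ∀ c : ℝ, 0 ≤ c →
      0 < Separatrix.height F W θhl θp u c ∧
      derivWithin (fun c' => Separatrix.height F W θhl θp u c') (Ici 0) c < 0 ∧
      ∀ γ : ℝ → ℝ × ℝ, Separatrix.IsSeparatrixTrajectory F W θhl θp c γ →
        (∃! τ : ℝ, 0 ≤ τ ∧ (γ τ).1 = u) ∧
        ∀ τ : ℝ, 0 ≤ τ → (γ τ).1 = u →
          IntegrableOn (fun t => Real.exp (-(c * t)) * (γ (t + τ)).2 ^ 2) (Ioi 0) ∧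
          HasDerivWithinAt (fun c' => Separatrix.height F W θhl θp u c')
            (-(1 / Separatrix.height F W θhl θp u c) *
              ∫ t in Ioi (0 : ℝ), Real.exp (-(c * t)) * (γ (t + τ)).2 ^ 2)
            (Ici 0) c := by
  exact proposition4p3_general F W θhl θp hθ hW hIW hF.continuousOn
    (differentiableAt_of_deriv_ne_zero hF'.ne) hzero
    (Separatrix.pos_of_deriv_neg_of_zero_iff hθ hIW hF.continuousOn hzero hF')
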